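/- Let $n\ge 5$ and let $K\subset\mathbb{R}^n$ be an origin-symmetric convex body (a compact convex set with non-empty interior, $K=-K$) that is a direct sum $K=A\oplus B$ of a non-degenerate segment $A$ and an $(n-1)$-dimensional convex body $B$; that is, $K=A+B=\{x+y : x\in A,\ y\in B\}$, where $A$ and $B$ lie in complementary linear subspaces of $\mathbb{R}^n$ (of dimensions $1$ and $n-1$, not necessarily orthogonal). (In suitable linear coordinates $(x,y)\in\mathbb{R}\times\mathbb{R}^{n-1}$, the norm with unit ball $K$ is $\|(x,y)\|_K=\max\{|x|,\|y\|_B\}$.) Then $K$ is not an intersection body. Here, with $\rho_K(\xi)=\max\{a : a\xi\in K\}$ the radial function of $K$, $K$ is called an intersection body if there is an even non-negative finite Borel measure $\mu$ on $S^{n-1}$ such that for every continuous function $g$ on $S^{n-1}$ $$\int_{S^{n-1}}\rho_K(\xi)\,g(\xi)\,d\xi=\int_{S^{n-1}}Rg(\xi)\,d\mu(\xi),\qquad Rg(\xi)=\int_{S^{n-1}\cap\xi^\perp}g(\theta)\,d\theta,$$ where $d\xi$ and $d\theta$ are the surface measures on $S^{n-1}$ and on the $(n-2)$-dimensional sphere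 $S^{n-1}\cap\xi^\perp$. -/

import Mathlib

open MeasureTheory Metric
open scoped Pointwise

/-- The radial function `ρ_K(ξ) = max {a : a ξ ∈ K}`. -/
noncomputable def radialFunction {n : ℕ} (K : Set (EuclideanSpace ℝ (Fin n)))
    (ξ : EuclideanSpace ℝ (Fin n)) : ℝ :=
  sSup {a : ℝ | a • ξ ∈ K}

/-- The inclusion of the unit sphere of the hyperplane `ξ^⊥` in the unit sphere `S^{n-1}`. -/
def sectionInclusion {n : ℕ} (ξ : EuclideanSpace ℝ (Fin n))
    (θ : sphere (0 : (Submodule.span ℝ {ξ})ᗮ) 1) :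
    sphere (0 : EuclideanSpace ℝ (Fin n)) 1 :=
  ⟨((θ : (Submodule.span ℝ {ξ})ᗮ) : EuclideanSpace ℝ (Fin n)), by
    have h := θ.2
    rw [mem_sphere_zero_iff_norm] at h ⊢
    exact h⟩

/-- The spherical Radon transform `Rg(ξ) = ∫_{S^{n-1} ∩ ξ^⊥} g(θ) dθ`, where `dθ` is the surface
measure of the `(n-2)`-dimensional unit sphere of the hyperplane `ξ^⊥`. -/
noncomputable def sphericalRadon {n : ℕ} (g : sphere (0 : EuclideanSpace ℝ (Fin n)) 1 → ℝ)
    (ξ : sphere (0 : EuclideanSpace ℝ (Fin n)) 1) : ℝ :=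
  ∫ θ, g (sectionInclusion (ξ : EuclideanSpace ℝ (Fin n)) θ)
    ∂((volume : Measure (Submodule.span ℝ {(ξ : EuclideanSpace ℝ (Fin n))})ᗮ).toSphere)

/-- A star body `K` is an intersection body if its radial function is the spherical Radon transform
of an even non-negative finite Borel measure `μ` on `S^{n-1}`: for every continuous `g` on
`S^{n-1}`, `∫ ρ_K(ξ) g(ξ) dξ = ∫ Rg(ξ) dμ(ξ)`, with `dξ` the surface measure of `S^{n-1}`. -/
def IsIntersectionBody {n : ℕ} (K : Set (EuclideanSpace ℝ (Fin n))) : Prop :=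
  ∃ μ : Measure (sphere (0 : EuclideanSpace ℝ (Fin n)) 1),
    IsFiniteMeasure μ ∧ μ.map (fun ξ => -ξ) = μ ∧
    ∀ g : C(sphere (0 : EuclideanSpace ℝ (Fin n)) 1, ℝ),
      ∫ ξ, radialFunction K (ξ : EuclideanSpace ℝ (Fin n)) * g ξ
          ∂((volume : Measure (EuclideanSpace ℝ (Fin n))).toSphere)
        = ∫ ξ, sphericalRadon g ξ ∂μ

/-- `K = A ⊕ B`: `K` is the Minkowski sum of `A` and `B`, and `A`, `B` lie in complementary linear
subspaces (which need not be orthogonal). -/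
def IsDirectSum {n : ℕ} (K A B : Set (EuclideanSpace ℝ (Fin n))) : Prop :=
  K = A + B ∧ ∃ E F : Submodule ℝ (EuclideanSpace ℝ (Fin n)),
    IsCompl E F ∧ A ⊆ (E : Set (EuclideanSpace ℝ (Fin n))) ∧
      B ⊆ (F : Set (EuclideanSpace ℝ (Fin n)))

/-! ### Polar coordinates and integrability of Gaussians with a `‖p‖⁻¹` singularity. -/

section Polar

open Set

/-! Duality argument with one explicit test function. If `K` is an intersection body, then `∫ (gauge
K)⁻¹ φ ≥ 0` for every continuous `φ` of Gaussian decay whose integral over each hyperplane through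
the origin is non-negative (`IsIntersectionBody.integral_inv_gauge_mul_nonneg`). A `φ` violating
this conclusion is built in coordinates `(x, y)` with `gauge K = max |x| (N y)`.

Take `φ = w(x) exp(-(x² + ‖y‖²)/2)` with `w(x) = |x| k(x²) exp(x²/2)`. On a hyperplane the standard
Gaussian gives `x` the law `N(0, v)` with `v ≤ 1`, so for `v > 0` the substitution `q = x²` turns
the integral of `φ` into a positive multiple of `∫ k(q) exp(-tq) dq` over `q > 0`, with `t = 1/(2v)
- 1/2 ≥ 0`. On the other side, Fubini turns `∫ (gauge K)⁻¹ φ` into a positive multiple of `∫ k(q)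
H(q) dq`, where `H(q)` is the Gaussian integral of `(max √q (N y))⁻¹` over `y`. So `k` has to be
non-negative against all `exp(-tq)` and negative against `H`.

This is possible because decaying exponentials are convex while `H` is not. Replacing `N y` by `max
√q (N y)` matters only where `‖y‖ ≲ √q`, so `H(0) - H(q) = O(q^((n-2)/2))`, which is `o(q)` exactly
because `n ≥ 5`; yet `H(1) < H(0)`. Hence convexity fails on `{0, z, 1}` for small `z`, and `k` is a
smeared version of this three-point test. -/

theorem integral_eq_integral_sphere_integral_ray {V : Type*} [NormedAddCommGroup V]
    [NormedSpace ℝ V] [FiniteDimensional ℝ V] [Nontrivial V] [MeasurableSpace V] [BorelSpace V]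
    (ν : Measure V) [ν.IsAddHaarMeasure] {ψ : V → ℝ} (hψ : Integrable ψ ν) :
    ∫ p, ψ p ∂ν = ∫ θ : sphere (0 : V) 1,
      (∫ r in Ioi (0 : ℝ), r ^ (Module.finrank ℝ V - 1) * ψ (r • (θ : V))) ∂ν.toSphere := by
  have hmp := ν.measurePreserving_homeomorphUnitSphereProd
  have hemb := (homeomorphUnitSphereProd V).measurableEmbedding
  set Ψ : sphere (0 : V) 1 × Ioi (0 : ℝ) → ℝ := fun x => ψ (x.2.1 • (x.1 : V)) with hΨ
  have hcomp : ∀ x : ({(0 : V)}ᶜ : Set V), Ψ (homeomorphUnitSphereProd V x) = ψ x := by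
    intro x
    have : ‖(x : V)‖ ≠ 0 := norm_ne_zero_iff.2 x.2
    simp [hΨ, smul_smul, this]
  have hint : Integrable Ψ (ν.toSphere.prod (.volumeIoiPow (Module.finrank ℝ V - 1))) := by
    rw [← hmp.integrable_comp_emb hemb]
    have h1 : Integrable (fun x : ({(0 : V)}ᶜ : Set V) => ψ x) (ν.comap (↑)) := by
      have := (integrableOn_iff_comap_subtypeVal (f := ψ) (μ := ν)
        (measurableSet_singleton (0 : V)).compl).1 hψ.integrableOn
      exact this
    exact h1.congr (.of_forall fun x => (hcomp x).symm)
  calc ∫ p, ψ p ∂ν = ∫ x : ({(0 : V)}ᶜ : Set V), ψ x ∂(ν.comap (↑)) := by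
        rw [integral_subtype_comap (measurableSet_singleton _).compl, restrict_compl_singleton]
    _ = ∫ x, Ψ x ∂(ν.toSphere.prod (.volumeIoiPow (Module.finrank ℝ V - 1))) := by
        rw [← hmp.integral_comp hemb]
        exact integral_congr_ae (.of_forall fun x => (hcomp x).symm)
    _ = _ := by
        rw [integral_prod _ hint]
        refine integral_congr_ae (.of_forall fun θ => ?_)
        simp only [hΨ, Measure.volumeIoiPow, ENNReal.ofReal]
        rw [integral_withDensity_eq_integral_smul,
          integral_subtype_comap measurableSet_Ioi fun r =>
            Real.toNNReal (r ^ (Module.finrank ℝ V - 1)) • ψ (r • (θ : V))]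
        · refine setIntegral_congr_fun measurableSet_Ioi fun r hr => ?_
          simp only [NNReal.smul_def, smul_eq_mul]
          rw [Real.coe_toNNReal _ (pow_nonneg (le_of_lt hr) _)]
        · exact (measurable_subtype_coe.pow_const _).real_toNNReal

theorem integrableOn_pow_mul_exp_neg_mul_sq {c : ℝ} (hc : 0 < c) (k : ℕ) :
    IntegrableOn (fun r : ℝ => r ^ k * Real.exp (-c * r ^ 2)) (Ioi 0) := by
  have := integrableOn_rpow_mul_exp_neg_mul_sq hc (s := (k : ℝ)) (by linarith [k.cast_nonneg (α := ℝ)])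
  simpa [Real.rpow_natCast] using this

theorem integrable_exp_neg_mul_norm_sq {V : Type*} [NormedAddCommGroup V]
    [NormedSpace ℝ V] [FiniteDimensional ℝ V] [Nontrivial V] [MeasurableSpace V] [BorelSpace V]
    (ν : Measure V) [ν.IsAddHaarMeasure] {c : ℝ} (hc : 0 < c) :
    Integrable (fun p : V => Real.exp (-c * ‖p‖ ^ 2)) ν := by
  rw [integrable_fun_norm_addHaar ν (f := fun r => Real.exp (-c * r ^ 2))]
  exact integrableOn_pow_mul_exp_neg_mul_sq hc _

theorem integrable_norm_inv_mul_exp_neg_mul_norm_sq {V : Type*} [NormedAddCommGroup V]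
    [NormedSpace ℝ V] [FiniteDimensional ℝ V] [MeasurableSpace V] [BorelSpace V]
    (ν : Measure V) [ν.IsAddHaarMeasure] (hV : 2 ≤ Module.finrank ℝ V) {c : ℝ} (hc : 0 < c) :
    Integrable (fun p : V => ‖p‖⁻¹ * Real.exp (-c * ‖p‖ ^ 2)) ν := by
  have : Nontrivial V := Module.nontrivial_of_finrank_pos (R := ℝ) (by omega)
  rw [integrable_fun_norm_addHaar ν (f := fun r => r⁻¹ * Real.exp (-c * r ^ 2))]
  refine (integrableOn_pow_mul_exp_neg_mul_sq hc (Module.finrank ℝ V - 2)).congr_fun ?_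
    measurableSet_Ioi
  intro r hr
  have hr' : r ≠ 0 := (ne_of_gt hr)
  obtain ⟨k, hk⟩ : ∃ k, Module.finrank ℝ V = k + 2 := ⟨_, (Nat.sub_add_cancel hV).symm⟩
  simp only [hk, smul_eq_mul]
  rw [show k + 2 - 1 = k + 1 by omega, show k + 2 - 2 = k by omega]
  field_simp
  ring

end Polar

/-! ### The positivity criterion for intersection bodies. -/

section TestFunction

open Set

theorem radialFunction_eq_inv_gauge {n : ℕ} {K : Set (EuclideanSpace ℝ (Fin n))}
    (hconv : Convex ℝ K) (hclosed : IsClosed K) (h0 : K ∈ nhds 0)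
    (hbdd : Bornology.IsBounded K) (ξ : EuclideanSpace ℝ (Fin n)) :
    radialFunction K ξ = (gauge K ξ)⁻¹ := by
  have habs : Absorbent ℝ K := absorbent_nhds_zero h0
  have hmem : ∀ x, x ∈ K ↔ gauge K x ≤ 1 := fun x => by
    rw [gauge_le_one_iff_mem_closure hconv h0, hclosed.closure_eq]
  rcases eq_or_ne ξ 0 with rfl | hξ
  · have : {a : ℝ | a • (0 : EuclideanSpace ℝ (Fin n)) ∈ K} = univ := by
      ext a; simp [mem_of_mem_nhds h0]
    -- At the origin both sides take the default value `0`: `sSup univ = 0` and `0⁻¹ = 0`.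
    rw [radialFunction, this, gauge_zero, inv_zero, Real.sSup_univ]
  · have hpos : 0 < gauge K ξ :=
      (gauge_pos habs (NormedSpace.isVonNBounded_iff ℝ |>.2 hbdd)).2 hξ
    refine IsGreatest.csSup_eq ⟨?_, ?_⟩
    · change (gauge K ξ)⁻¹ • ξ ∈ K
      rw [hmem, gauge_smul_of_nonneg (inv_nonneg.2 hpos.le), smul_eq_mul, inv_mul_cancel₀ hpos.ne']
    · intro a ha
      rcases le_or_gt a 0 with h | h
      · exact h.trans (inv_nonneg.2 hpos.le)
      · have := (hmem _).1 ha
        rw [gauge_smul_of_nonneg h.le, smul_eq_mul] at this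
        rwa [le_inv_comm₀ h hpos, ← one_div, le_div_iff₀ h, mul_comm]

/-- Makes the ray integral of `φ` admissible as the continuous `g` in the definition of intersection
body; the Gaussian bound is uniform in `θ`. -/
theorem continuous_integral_ray {n : ℕ} {φ : EuclideanSpace ℝ (Fin n) → ℝ} (hφ : Continuous φ)
    {M c : ℝ} (hc : 0 < c) (hbd : ∀ p, |φ p| ≤ M * Real.exp (-c * ‖p‖ ^ 2)) (k : ℕ) :
    Continuous fun θ : sphere (0 : EuclideanSpace ℝ (Fin n)) 1 =>
      ∫ r in Ioi (0 : ℝ), r ^ k * φ (r • (θ : EuclideanSpace ℝ (Fin n))) := by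
  refine continuous_of_dominated (bound := fun r => M * (r ^ k * Real.exp (-c * r ^ 2)))
    ?_ ?_ ?_ ?_
  · intro θ
    exact (by fun_prop : Continuous fun r : ℝ => r ^ k * φ (r • (θ : EuclideanSpace ℝ (Fin n)))
      ).aestronglyMeasurable
  · intro θ
    filter_upwards [ae_restrict_mem measurableSet_Ioi] with r hr
    have hr' : (0 : ℝ) < r := hr
    have h := hbd (r • (θ : EuclideanSpace ℝ (Fin n)))
    have hθ : ‖(θ : EuclideanSpace ℝ (Fin n))‖ = 1 := by simp
    rw [norm_smul, hθ, mul_one, Real.norm_eq_abs, sq_abs] at h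
    rw [norm_mul, Real.norm_eq_abs, Real.norm_eq_abs, abs_of_pos (pow_pos hr' k)]
    calc r ^ k * _ ≤ r ^ k * (M * Real.exp (-c * r ^ 2)) := by gcongr
      _ = _ := by ring
  · exact (integrableOn_pow_mul_exp_neg_mul_sq hc k).const_mul M
  · exact .of_forall fun r => by fun_prop

/-- Test the definition with `g θ = ∫ r ^ (n - 2) φ(r θ) dr`. In polar coordinates `∫ ρ_K g` is the
integral of `(gauge K)⁻¹ φ`, and `Rg ξ` is the integral of `φ` over `ξ^⊥`. -/
theorem IsIntersectionBody.integral_inv_gauge_mul_nonneg {n : ℕ} (hn : 2 ≤ n)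
    {K : Set (EuclideanSpace ℝ (Fin n))} (hconv : Convex ℝ K) (hclosed : IsClosed K)
    (h0 : K ∈ nhds 0) (hbdd : Bornology.IsBounded K) (hK : IsIntersectionBody K)
    {φ : EuclideanSpace ℝ (Fin n) → ℝ} (hφ : Continuous φ)
    {M c : ℝ} (hc : 0 < c) (hbd : ∀ p, |φ p| ≤ M * Real.exp (-c * ‖p‖ ^ 2))
    (hpos : ∀ ξ : EuclideanSpace ℝ (Fin n), ξ ≠ 0 →
      0 ≤ ∫ p : (Submodule.span ℝ {ξ})ᗮ, φ p) :
    0 ≤ ∫ p, (gauge K p)⁻¹ * φ p := by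
  obtain ⟨μ, -, -, h⟩ := hK
  have : Nontrivial (EuclideanSpace ℝ (Fin n)) :=
    Module.nontrivial_of_finrank_pos (R := ℝ) (by simp; omega)
  -- The exponent `n - 2` serves both sides: it is the polar weight of a hyperplane, and the weight
  -- `r ^ (n - 1)` of the whole space times the `r⁻¹` coming from `(gauge K)⁻¹`.
  set g : C(sphere (0 : EuclideanSpace ℝ (Fin n)) 1, ℝ) :=
    ⟨_, continuous_integral_ray hφ hc hbd (n - 2)⟩ with hg
  have hgauge : Continuous (gauge K) := continuous_gauge hconv h0
  obtain ⟨R, hR0, hR⟩ : ∃ R : ℝ, 0 < R ∧ K ⊆ closedBall 0 R := by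
    obtain ⟨R, hR⟩ := hbdd.subset_closedBall 0
    exact ⟨max R 1, by positivity, hR.trans (closedBall_subset_closedBall (le_max_left _ _))⟩
  have hM : 0 ≤ M := by
    have := (abs_nonneg _).trans (hbd 0)
    simpa using this
  have hint : Integrable fun p => (gauge K p)⁻¹ * φ p := by
    refine ((integrable_norm_inv_mul_exp_neg_mul_norm_sq volume (by simpa using hn) hc).const_mul
      (R * M)).mono' ((hgauge.measurable.inv.mul hφ.measurable).aestronglyMeasurable)
      (.of_forall fun p => ?_)
    rcases eq_or_ne p 0 with rfl | hp
    · simp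
    have h1 : ‖p‖ / R ≤ gauge K p :=
      le_gauge_of_subset_closedBall (absorbent_nhds_zero (𝕜 := ℝ) h0) hR0.le hR
    have h2 : (gauge K p)⁻¹ ≤ R * ‖p‖⁻¹ := by
      rw [← div_eq_mul_inv, ← inv_div]
      exact inv_anti₀ (by have := norm_pos_iff.2 hp; positivity) h1
    rw [norm_mul, Real.norm_eq_abs, Real.norm_eq_abs, abs_of_nonneg (inv_nonneg.2 (gauge_nonneg _))]
    calc _ ≤ (R * ‖p‖⁻¹) * (M * Real.exp (-c * ‖p‖ ^ 2)) := by
          gcongr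
          exact hbd p
      _ = _ := by ring
  have hleft : ∫ p, (gauge K p)⁻¹ * φ p =
      ∫ ξ, radialFunction K (ξ : EuclideanSpace ℝ (Fin n)) * g ξ
          ∂((volume : Measure (EuclideanSpace ℝ (Fin n))).toSphere) := by
    rw [integral_eq_integral_sphere_integral_ray volume hint]
    refine integral_congr_ae (.of_forall fun θ => ?_)
    simp only [hg, ContinuousMap.coe_mk]
    rw [radialFunction_eq_inv_gauge hconv hclosed h0 hbdd, ← integral_const_mul]
    refine setIntegral_congr_fun measurableSet_Ioi fun r hr => ?_
    have hr' : (0 : ℝ) < r := hr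
    obtain ⟨k, rfl⟩ : ∃ k, n = k + 2 := ⟨_, (Nat.sub_add_cancel hn).symm⟩
    simp only [finrank_euclideanSpace, Fintype.card_fin, gauge_smul_of_nonneg hr'.le, smul_eq_mul]
    rw [show k + 2 - 1 = k + 1 by omega, show k + 2 - 2 = k by omega, pow_succ, mul_inv]
    field_simp
  rw [hleft, h g]
  refine integral_nonneg fun ξ => ?_
  have hξ : (ξ : EuclideanSpace ℝ (Fin n)) ≠ 0 := ne_zero_of_mem_unit_sphere ξ
  have hfin : Module.finrank ℝ (Submodule.span ℝ {(ξ : EuclideanSpace ℝ (Fin n))})ᗮ = n - 1 := by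
    have h1 := Submodule.finrank_add_finrank_orthogonal
      (Submodule.span ℝ {(ξ : EuclideanSpace ℝ (Fin n))})
    rw [finrank_span_singleton hξ, finrank_euclideanSpace, Fintype.card_fin] at h1
    omega
  have : Nontrivial (Submodule.span ℝ {(ξ : EuclideanSpace ℝ (Fin n))})ᗮ :=
    Module.nontrivial_of_finrank_pos (R := ℝ) (by omega)
  have hint' : Integrable fun p : (Submodule.span ℝ {(ξ : EuclideanSpace ℝ (Fin n))})ᗮ =>
      φ p := by
    refine ((integrable_exp_neg_mul_norm_sq volume hc).const_mul M).mono'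
      (hφ.comp continuous_subtype_val).aestronglyMeasurable (.of_forall fun p => ?_)
    exact hbd p
  have := hpos ξ hξ
  rw [integral_eq_integral_sphere_integral_ray volume hint', hfin] at this
  exact this

end TestFunction

/-! ### A test function on the half-line that detects failure of convexity. -/

section OneDimensional

open Set

theorem integral_abs_mul_comp_sq (k : ℝ → ℝ) :
    ∫ x : ℝ, |x| * k (x ^ 2) = ∫ q in Ioi (0 : ℝ), k q := by
  have h1 : ∫ x : ℝ, |x| * k (x ^ 2) = 2 * ∫ x in Ioi (0 : ℝ), x * k (x ^ 2) := by
    rw [← integral_comp_abs (f := fun x => x * k (x ^ 2))]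
    simp
  rw [h1, ← integral_comp_rpow_Ioi_of_pos (g := k) (p := 2) (by norm_num), ← integral_const_mul]
  refine setIntegral_congr_fun measurableSet_Ioi fun x _ => ?_
  simp only [smul_eq_mul]
  rw [show (2 : ℝ) - 1 = 1 by norm_num, Real.rpow_one, Real.rpow_two]
  ring

/-- The tent function supported on `[0, z]`. -/
noncomputable def tent (z q : ℝ) : ℝ := max 0 (min q (z - q))

theorem tent_nonneg (z q : ℝ) : 0 ≤ tent z q := le_max_left _ _

theorem tent_eq_zero {z q : ℝ} (h : q ∉ Ioo 0 z) : tent z q = 0 := by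
  refine max_eq_left ?_
  by_contra! h'
  exact h ⟨(lt_min_iff.1 h').1, by linarith [(lt_min_iff.1 h').2]⟩

theorem tent_pos {z q : ℝ} (h : q ∈ Ioo 0 z) : 0 < tent z q :=
  lt_max_of_lt_right (lt_min h.1 (by linarith [h.2]))

theorem continuous_tent (z : ℝ) : Continuous (tent z) := by
  unfold tent; fun_prop

theorem hasCompactSupport_tent (z : ℝ) : HasCompactSupport (tent z) :=
  HasCompactSupport.intro isCompact_Icc (K := Icc 0 z)
    fun _ hq => tent_eq_zero fun h => hq (Ioo_subset_Icc_self h)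

theorem integral_tent_pos {z : ℝ} (hz : 0 < z) : 0 < ∫ q, tent z q := by
  refine (continuous_tent z).integral_pos_of_hasCompactSupport_nonneg_nonzero
    (hasCompactSupport_tent z) (tent_nonneg z) (x := z / 2) (tent_pos ⟨?_, ?_⟩).ne' <;> linarith

/-- The combination of translated tents that tests convexity on `{0, z, 1}`. -/
noncomputable def convexityTest (z q : ℝ) : ℝ :=
  (1 - z) * tent z q + z * tent z (q - 1) - tent z (q - z)

theorem continuous_convexityTest (z : ℝ) : Continuous (convexityTest z) := by
  have := continuous_tent z
  unfold convexityTest; fun_prop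

theorem convexityTest_eq_zero {z q : ℝ} (hz : z ≤ 1) (hq : 2 ≤ q) :
    convexityTest z q = 0 := by
  unfold convexityTest
  rw [tent_eq_zero (q := q), tent_eq_zero (q := q - 1), tent_eq_zero (q := q - z)]
  · ring
  all_goals
    rintro ⟨h1, h2⟩
    linarith

theorem integrable_tent_sub_mul {h : ℝ → ℝ} (hh : Antitone h) (z s : ℝ) :
    Integrable fun q => tent z (q - s) * h q := by
  have h1 : Continuous fun q => tent z (q - s) := (continuous_tent z).comp (by fun_prop)
  have h2 : HasCompactSupport fun q => tent z (q - s) :=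
    (hasCompactSupport_tent z).comp_homeomorph (Homeomorph.subRight s)
  exact hh.locallyIntegrable.integrable_smul_left_of_hasCompactSupport h1 h2

theorem integrable_tent_mul {h : ℝ → ℝ} (hh : Antitone h) (z s : ℝ) :
    Integrable fun q => tent z q * h (q + s) := by
  simpa using integrable_tent_sub_mul (h := fun q => h (q + s))
    (fun a b hab => hh (by linarith)) z 0

theorem setIntegral_tent_sub_mul (h : ℝ → ℝ) (z : ℝ) {s : ℝ} (hs : 0 ≤ s) :
    ∫ q in Ioi (0 : ℝ), tent z (q - s) * h q = ∫ q, tent z q * h (q + s) := by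
  rw [setIntegral_eq_integral_of_forall_compl_eq_zero,
    ← integral_sub_right_eq_self (fun q => tent z q * h (q + s)) s]
  · simp only [sub_add_cancel]
  · intro q hq
    rw [tent_eq_zero, zero_mul]
    rintro ⟨h1, -⟩
    exact hq (by simp only [mem_Ioi]; linarith)

/-- The substitution `q = x ^ 2` absorbs `|x|`; moving the translations from the tents to `h` then
leaves the three-point convexity defect of `h` at `q`, `q + z`, `q + 1`, averaged over a tent. -/
theorem integral_abs_mul_convexityTest_mul {h : ℝ → ℝ} (hh : Antitone h) {z : ℝ} (hz : 0 ≤ z) :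
    ∫ x : ℝ, |x| * (convexityTest z (x ^ 2) * h (x ^ 2)) =
      ∫ q, tent z q * ((1 - z) * h q + z * h (q + 1) - h (q + z)) := by
  have i1 := integrable_tent_sub_mul hh z 0
  have i2 := integrable_tent_sub_mul hh z 1
  have i3 := integrable_tent_sub_mul hh z z
  have j1 := integrable_tent_mul hh z 0
  have j2 := integrable_tent_mul hh z 1
  have j3 := integrable_tent_mul hh z z
  have e1 := setIntegral_tent_sub_mul h z le_rfl
  have e2 := setIntegral_tent_sub_mul h z zero_le_one
  have e3 := setIntegral_tent_sub_mul h z hz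
  rw [integral_abs_mul_comp_sq fun q => convexityTest z q * h q]
  calc ∫ q in Ioi (0 : ℝ), convexityTest z q * h q
      = ∫ q in Ioi (0 : ℝ), ((1 - z) * (tent z (q - 0) * h q) + z * (tent z (q - 1) * h q)
          - tent z (q - z) * h q) := by
        refine integral_congr_ae (.of_forall fun q => ?_)
        simp only [convexityTest, sub_zero]
        ring
    _ = ∫ q, ((1 - z) * (tent z q * h (q + 0)) + z * (tent z q * h (q + 1))
          - tent z q * h (q + z)) := by
        rw [integral_sub, integral_add, integral_const_mul, integral_const_mul, e1, e2, e3,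
          integral_sub, integral_add, integral_const_mul, integral_const_mul]
        · exact j1.const_mul _
        · exact j2.const_mul _
        · exact (j1.const_mul _).add (j2.const_mul _)
        · exact j3
        · exact (i1.const_mul _).integrableOn
        · exact (i2.const_mul _).integrableOn
        · exact ((i1.const_mul _).add (i2.const_mul _)).integrableOn
        · exact i3.integrableOn
    _ = _ := by
        refine integral_congr_ae (.of_forall fun q => ?_)
        simp only [add_zero]
        ring

theorem integral_abs_mul_convexityTest_mul_exp_nonneg {z t : ℝ} (hz0 : 0 ≤ z) (hz1 : z ≤ 1)
    (ht : 0 ≤ t) :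
    0 ≤ ∫ x : ℝ, |x| * (convexityTest z (x ^ 2) * Real.exp (-t * x ^ 2)) := by
  have hanti : Antitone fun q : ℝ => Real.exp (-t * q) := fun a b hab =>
    Real.exp_le_exp.2 (by nlinarith)
  rw [integral_abs_mul_convexityTest_mul hanti hz0]
  refine integral_nonneg fun q => mul_nonneg (tent_nonneg _ _) ?_
  have := convexOn_exp.2 (mem_univ (-t * q)) (mem_univ (-t * (q + 1))) (sub_nonneg.2 hz1) hz0
    (by ring)
  simp only [smul_eq_mul] at this
  rw [show (1 - z) * (-t * q) + z * (-t * (q + 1)) = -t * (q + z) by ring] at this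
  exact sub_nonneg.2 this

/-- The tent lives on `0 < q < z`, where monotonicity bounds the defect by `(1 - z) * H 0 + z * H 1
- H (2 * z)`; `hlt` says that this is negative. -/
theorem integral_abs_mul_convexityTest_mul_neg {H : ℝ → ℝ} (hH : Antitone H) {z : ℝ} (hz0 : 0 < z)
    (hz1 : z ≤ 1) (hlt : H 0 - H (2 * z) < z * (H 0 - H 1)) :
    ∫ x : ℝ, |x| * (convexityTest z (x ^ 2) * H (x ^ 2)) < 0 := by
  rw [integral_abs_mul_convexityTest_mul hH hz0.le]
  have hle : ∫ q, tent z q * ((1 - z) * H q + z * H (q + 1) - H (q + z)) ≤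
      ∫ q, tent z q * ((1 - z) * H 0 + z * H 1 - H (2 * z)) := by
    refine integral_mono ?_ (((continuous_tent z).integrable_of_hasCompactSupport
      (hasCompactSupport_tent z)).mul_const _) fun q => ?_
    · have := (((integrable_tent_mul hH z 0).const_mul (1 - z)).add
        ((integrable_tent_mul hH z 1).const_mul z)).sub (integrable_tent_mul hH z z)
      refine this.congr (.of_forall fun q => ?_)
      simp only [Pi.add_apply, Pi.sub_apply, add_zero]
      ring
    · by_cases hq : q ∈ Ioo 0 z
      · have h1 : H q ≤ H 0 := hH hq.1.le
        have h2 : H (q + 1) ≤ H 1 := hH (by linarith [hq.1])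
        have h3 : H (2 * z) ≤ H (q + z) := hH (by linarith [hq.2])
        have h4 : (1 - z) * H q ≤ (1 - z) * H 0 := by gcongr
        have h5 : z * H (q + 1) ≤ z * H 1 := by gcongr
        exact mul_le_mul_of_nonneg_left (by linarith) (tent_nonneg _ _)
      · simp [tent_eq_zero hq]
  refine hle.trans_lt ?_
  rw [integral_mul_const]
  exact mul_neg_of_pos_of_neg (integral_tent_pos hz0) (by linarith)

end OneDimensional

/-! ### Gaussian integrals over subspaces. -/

section Gaussian

open ProbabilityTheory

/-- Uniqueness of Haar measure; only the sign of the Jacobian factor is needed later. -/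
theorem exists_integral_comp_linearEquiv {V W : Type*} [NormedAddCommGroup V] [NormedSpace ℝ V]
    [FiniteDimensional ℝ V] [MeasurableSpace V] [BorelSpace V] [NormedAddCommGroup W]
    [NormedSpace ℝ W] [FiniteDimensional ℝ W] [MeasurableSpace W] [BorelSpace W] (e : V ≃ₗ[ℝ] W)
    (μ : Measure V) [μ.IsAddHaarMeasure] (ν : Measure W) [ν.IsAddHaarMeasure] :
    ∃ c : ℝ, 0 < c ∧ ∀ f : W → ℝ, ∫ p, f (e p) ∂μ = c * ∫ p, f p ∂ν := by
  set e' := e.toContinuousLinearEquiv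
  have : (μ.map e').IsAddHaarMeasure := e'.isAddHaarMeasure_map μ
  refine ⟨(μ.map e').addHaarScalarFactor ν, ?_, fun f => ?_⟩
  · exact_mod_cast Measure.addHaarScalarFactor_pos_of_isAddHaarMeasure _ _
  · have h : μ.map e' = (μ.map e').addHaarScalarFactor ν • ν :=
      Measure.isAddLeftInvariant_eq_smul _ _
    have h2 : ∫ p, f p ∂(μ.map e') = ∫ p, f (e p) ∂μ :=
      e'.toHomeomorph.measurableEmbedding.integral_map f
    rw [← h2]
    conv_lhs => rw [h]
    rw [integral_smul_nnreal_measure]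
    rfl

variable {V : Type*} [NormedAddCommGroup V] [InnerProductSpace ℝ V] [FiniteDimensional ℝ V]
  [MeasurableSpace V] [BorelSpace V]

theorem integrable_exp_neg_half_norm_sq :
    Integrable fun p : V => Real.exp (-(1 / 2) * ‖p‖ ^ 2) := by
  refine Integrable.of_integral_ne_zero ?_
  rw [GaussianFourier.integral_rexp_neg_mul_sq_norm (by norm_num)]
  positivity

/-- Both finite measures have the same characteristic function. -/
theorem withDensity_exp_neg_half_norm_sq :
    (volume : Measure V).withDensity (fun p => ENNReal.ofReal (Real.exp (-(1 / 2) * ‖p‖ ^ 2))) =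
      ENNReal.ofReal (∫ p : V, Real.exp (-(1 / 2) * ‖p‖ ^ 2)) • stdGaussian V := by
  have hint := integrable_exp_neg_half_norm_sq (V := V)
  have : IsFiniteMeasure ((volume : Measure V).withDensity
      (fun p => ENNReal.ofReal (Real.exp (-(1 / 2) * ‖p‖ ^ 2)))) :=
    isFiniteMeasure_withDensity_ofReal hint.2
  have : IsFiniteMeasure (ENNReal.ofReal (∫ p : V, Real.exp (-(1 / 2) * ‖p‖ ^ 2)) •
      stdGaussian V) := Measure.smul_finite _ ENNReal.ofReal_ne_top
  have hC : ((∫ p : V, Real.exp (-(1 / 2) * ‖p‖ ^ 2) : ℝ) : ℂ) =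
      (Real.pi / (1 / 2 : ℂ)) ^ (Module.finrank ℝ V / 2 : ℂ) := by
    rw [← GaussianFourier.integral_cexp_neg_mul_sq_norm (V := V) (b := 1 / 2) (by norm_num),
      ← integral_complex_ofReal]
    simp
  refine Measure.ext_of_charFun ?_
  ext t
  rw [charFun_apply, charFun_apply, integral_smul_measure, ← charFun_apply (μ := stdGaussian V),
    charFun_stdGaussian,
    ENNReal.toReal_ofReal (integral_nonneg fun p => (Real.exp_pos _).le), Complex.real_smul, hC]
  simp only [ENNReal.ofReal]
  rw [integral_withDensity_eq_integral_smul (by fun_prop)]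
  have := GaussianFourier.integral_cexp_neg_mul_sq_norm_add (V := V) (b := 1 / 2) (by norm_num)
    Complex.I t
  calc _ = ∫ v : V, Complex.exp (-(1 / 2 : ℂ) * ‖v‖ ^ 2 + Complex.I * (inner ℝ t v : ℝ)) := by
        refine integral_congr_ae (.of_forall fun v => ?_)
        simp only [NNReal.smul_def, Real.coe_toNNReal _ (Real.exp_pos _).le, Complex.real_smul]
        rw [Complex.ofReal_exp, ← Complex.exp_add, real_inner_comm]
        push_cast
        ring_nf
    _ = _ := by
        rw [this]
        congr 2
        rw [Complex.I_sq]
        ring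

theorem integral_comp_dual_mul_exp (L : StrongDual ℝ V) {f : ℝ → ℝ} (hf : Continuous f) :
    ∫ p : V, f (L p) * Real.exp (-(1 / 2) * ‖p‖ ^ 2) =
      (∫ p : V, Real.exp (-(1 / 2) * ‖p‖ ^ 2)) * ∫ x, f x ∂(gaussianReal 0 (‖L‖₊ ^ 2)) := by
  have hmap : (stdGaussian V).map L = gaussianReal 0 (‖L‖₊ ^ 2) := by
    rw [IsGaussian.map_eq_gaussianReal, integral_strongDual_stdGaussian, variance_dual_stdGaussian]
    congr 1
    ext
    simp
  calc _ = ∫ p, f (L p) ∂((volume : Measure V).withDensity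
        (fun p => ENNReal.ofReal (Real.exp (-(1 / 2) * ‖p‖ ^ 2)))) := by
        simp only [ENNReal.ofReal]
        rw [integral_withDensity_eq_integral_smul (by fun_prop)]
        refine integral_congr_ae (.of_forall fun v => ?_)
        simp only [NNReal.smul_def, Real.coe_toNNReal _ (Real.exp_pos _).le, smul_eq_mul]
        ring
    _ = _ := by
        rw [withDensity_exp_neg_half_norm_sq, integral_smul_measure,
          ENNReal.toReal_ofReal (integral_nonneg fun p => (Real.exp_pos _).le), smul_eq_mul,
          ← hmap, integral_map L.continuous.aemeasurable hf.aestronglyMeasurable]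

/-- The profile of the test function along the segment. -/
noncomputable def testProfile (z x : ℝ) : ℝ :=
  |x| * (convexityTest z (x ^ 2) * Real.exp (1 / 2 * x ^ 2))

theorem continuous_testProfile (z : ℝ) : Continuous (testProfile z) := by
  have := continuous_convexityTest z
  unfold testProfile; fun_prop

theorem exists_abs_testProfile_le {z : ℝ} (hz1 : z ≤ 1) :
    ∃ M, ∀ x, |testProfile z x| ≤ M := by
  have hs : HasCompactSupport (testProfile z) := by
    refine HasCompactSupport.intro isCompact_Icc (K := Set.Icc (-2) 2) fun x hx => ?_
    have : 2 ≤ x ^ 2 := by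
      by_contra! h
      exact hx ⟨by nlinarith, by nlinarith⟩
    simp [testProfile, convexityTest_eq_zero hz1 this]
  exact hs.exists_bound_of_continuous (continuous_testProfile z)

/-- The factor `exp (x ^ 2 / 2)` of the profile turns the density of variance `v` into `exp (-t * x
^ 2)` with `t = 1 / (2 * v) - 1 / 2`, and `t ≥ 0` because `v ≤ 1`. -/
theorem integral_testProfile_gaussianReal_nonneg {z : ℝ} (hz0 : 0 ≤ z) (hz1 : z ≤ 1) {v : NNReal}
    (hv : v ≤ 1) : 0 ≤ ∫ x, testProfile z x ∂(gaussianReal 0 v) := by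
  -- The degenerate law is the Dirac mass at `0`, where `|x|` kills the profile.
  rcases eq_or_ne v 0 with rfl | hv0
  · simp [testProfile]
  · have hvpos : (0 : ℝ) < v := by positivity
    have hv1 : (v : ℝ) ≤ 1 := by exact_mod_cast hv
    rw [integral_gaussianReal_eq_integral_smul hv0]
    have ht : 0 ≤ 1 / (2 * (v : ℝ)) - 1 / 2 := by
      rw [sub_nonneg]
      gcongr
      linarith
    have := integral_abs_mul_convexityTest_mul_exp_nonneg hz0 hz1 ht
    calc 0 ≤ (√(2 * Real.pi * v))⁻¹ * _ := mul_nonneg (by positivity) this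
      _ = _ := by
        rw [← integral_const_mul]
        refine integral_congr_ae (.of_forall fun x => ?_)
        simp only [gaussianPDFReal, testProfile, smul_eq_mul, sub_zero]
        rw [show -(1 / (2 * (v : ℝ)) - 1 / 2) * x ^ 2 = -x ^ 2 / (2 * v) + 1 / 2 * x ^ 2 by ring,
          Real.exp_add]
        ring

/-- Applied with `V` a hyperplane and `T` the coordinate map. On the range of `T`, `L` has a centred
Gaussian law whose variance is the squared norm of its restriction, hence at most `1`. -/
theorem integral_testProfile_mul_exp_nonneg {z : ℝ} (hz0 : 0 ≤ z) (hz1 : z ≤ 1)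
    {W : Type*} [NormedAddCommGroup W] [InnerProductSpace ℝ W]
    (T : V →ₗ[ℝ] W) (hT : Function.Injective T) (L : StrongDual ℝ W) (hL : ‖L‖ ≤ 1) :
    0 ≤ ∫ p : V, testProfile z (L (T p)) * Real.exp (-(1 / 2) * ‖T p‖ ^ 2) := by
  borelize W
  set e := LinearEquiv.ofInjective T hT
  obtain ⟨c, hc, h⟩ := exists_integral_comp_linearEquiv e volume volume
  have h1 := h fun q => testProfile z (L q) * Real.exp (-(1 / 2) * ‖q‖ ^ 2)
  have h2 := integral_comp_dual_mul_exp (L.comp (LinearMap.range T).subtypeL)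
    (continuous_testProfile z)
  have hL' : ‖L.comp (LinearMap.range T).subtypeL‖ ≤ 1 :=
    (L.opNorm_comp_le _).trans (mul_le_one₀ hL (norm_nonneg _) (Submodule.norm_subtypeL_le _))
  have hv : ‖L.comp (LinearMap.range T).subtypeL‖₊ ^ 2 ≤ 1 := by
    apply pow_le_one₀ zero_le
    exact_mod_cast hL'
  have h3 := integral_testProfile_gaussianReal_nonneg hz0 hz1 hv
  have h4 : 0 ≤ ∫ q : LinearMap.range T, testProfile z (L q) * Real.exp (-(1 / 2) * ‖q‖ ^ 2) := by
    refine le_of_le_of_eq (mul_nonneg ?_ h3) h2.symm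
    exact integral_nonneg fun p => (Real.exp_pos _).le
  have h5 := mul_nonneg hc.le h4
  rw [← h1] at h5
  exact h5

end Gaussian

/-! ### The Gaussian profile is flat at `0` but not constant. -/

section Estimates

open Set

theorem inv_max_le {Y : Type*} [NormedAddCommGroup Y] {N : Y → ℝ} {c : ℝ} {y : Y}
    (hc : 0 < c) (hN : c * ‖y‖ ≤ N y) (hy : y ≠ 0) {s t : ℝ}
    (h : s ≤ t) : (max t (N y))⁻¹ ≤ (max s (N y))⁻¹ := by
  have : 0 < N y := lt_of_lt_of_le (mul_pos hc (norm_pos_iff.2 hy)) hN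
  exact inv_anti₀ (lt_max_of_lt_right this) (max_le_max_right _ h)

theorem inv_max_le_norm_inv {Y : Type*} [NormedAddCommGroup Y] {N : Y → ℝ} {c : ℝ} {y : Y}
    (hc : 0 < c) (hN : c * ‖y‖ ≤ N y) (hy : y ≠ 0) (s : ℝ) :
    (max s (N y))⁻¹ ≤ c⁻¹ * ‖y‖⁻¹ := by
  rw [← mul_inv]
  exact inv_anti₀ (mul_pos hc (norm_pos_iff.2 hy)) (hN.trans (le_max_right _ _))

variable {V : Type*} [NormedAddCommGroup V] [InnerProductSpace ℝ V] [FiniteDimensional ℝ V]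
  [MeasurableSpace V] [BorelSpace V]

/-- The Gaussian average of `(max |t| (N y))⁻¹` as a function of `q = t ^ 2`. -/
noncomputable def gaussianProfile (N : V → ℝ) (q : ℝ) : ℝ :=
  ∫ y, (max √q (N y))⁻¹ * Real.exp (-(1 / 2) * ‖y‖ ^ 2)

variable {N : V → ℝ} {c : ℝ}

theorem integrable_inv_max_mul_exp (hV : 2 ≤ Module.finrank ℝ V) (hNc : Continuous N) (hc : 0 < c)
    (hN : ∀ y, c * ‖y‖ ≤ N y) (s : ℝ) :
    Integrable fun y => (max s (N y))⁻¹ * Real.exp (-(1 / 2) * ‖y‖ ^ 2) := by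
  have : Nontrivial V := Module.nontrivial_of_finrank_pos (R := ℝ) (by omega)
  refine ((integrable_norm_inv_mul_exp_neg_mul_norm_sq volume hV (c := 1 / 2)
    (by norm_num)).const_mul c⁻¹).mono' ?_ ?_
  · have : Measurable fun y => (max s (N y))⁻¹ := (by fun_prop : Continuous fun y =>
      max s (N y)).measurable.inv
    exact (this.mul (by fun_prop)).aestronglyMeasurable
  · filter_upwards [Measure.ae_ne volume (0 : V)] with y hy
    have h0 : 0 ≤ (max s (N y))⁻¹ := inv_nonneg.2
      (le_max_of_le_right (le_trans (by positivity) (hN y)))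
    rw [norm_mul, Real.norm_eq_abs, Real.norm_eq_abs, abs_of_nonneg h0,
      abs_of_pos (Real.exp_pos _), ← mul_assoc]
    gcongr
    exact inv_max_le_norm_inv hc (hN y) hy s

theorem antitone_gaussianProfile (hV : 2 ≤ Module.finrank ℝ V) (hNc : Continuous N) (hc : 0 < c)
    (hN : ∀ y, c * ‖y‖ ≤ N y) : Antitone (gaussianProfile N) := by
  have : Nontrivial V := Module.nontrivial_of_finrank_pos (R := ℝ) (by omega)
  intro p q hpq
  refine integral_mono_ae (integrable_inv_max_mul_exp hV hNc hc hN _)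
    (integrable_inv_max_mul_exp hV hNc hc hN _) ?_
  -- The point `y = 0` must be discarded: there the maximum may be `0`, and the convention `0⁻¹ = 0`
  -- breaks monotonicity.
  filter_upwards [Measure.ae_ne volume (0 : V)] with y hy
  gcongr ?_ * _
  exact inv_max_le hc (hN y) hy (Real.sqrt_le_sqrt hpq)

theorem gaussianProfile_one_lt (hV : 2 ≤ Module.finrank ℝ V) (hNc : Continuous N) (hc : 0 < c)
    (hN : ∀ y, c * ‖y‖ ≤ N y) (hN0 : N 0 = 0) : gaussianProfile N 1 < gaussianProfile N 0 := by
  have : Nontrivial V := Module.nontrivial_of_finrank_pos (R := ℝ) (by omega)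
  have i0 := integrable_inv_max_mul_exp hV hNc hc hN √0
  have i1 := integrable_inv_max_mul_exp hV hNc hc hN √1
  rw [← sub_pos, gaussianProfile, gaussianProfile, ← integral_sub i0 i1,
    integral_pos_iff_support_of_nonneg_ae]
  · have hopen : IsOpen {y : V | N y < 1} := isOpen_lt hNc continuous_const
    have hpos : 0 < volume ({y : V | N y < 1} \ {0}) := by
      rw [measure_sdiff_null (measure_singleton _)]
      exact hopen.measure_pos _ ⟨0, by simp [hN0]⟩
    refine hpos.trans_le (measure_mono ?_)
    rintro y ⟨hy1, hy0⟩
    have hNy : 0 < N y := lt_of_lt_of_le (mul_pos hc (norm_pos_iff.2 hy0)) (hN y)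
    have hy1' : N y < 1 := hy1
    rw [Function.mem_support, Real.sqrt_zero, Real.sqrt_one, max_eq_right hNy.le,
      max_eq_left hy1'.le, ← sub_mul]
    refine (mul_pos (sub_pos.2 ?_) (Real.exp_pos _)).ne'
    exact inv_strictAnti₀ hNy hy1'
  · filter_upwards [Measure.ae_ne volume (0 : V)] with y hy
    refine sub_nonneg.2 ?_
    gcongr ?_ * _
    exact inv_max_le hc (hN y) hy (Real.sqrt_le_sqrt zero_le_one)
  · exact i0.sub i1

theorem integrable_and_integral_indicator_norm_inv_le (hV : 2 ≤ Module.finrank ℝ V) {R : ℝ} (hR : 0 ≤ R) :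
    Integrable (fun y : V => (Iic R).indicator (fun r => r⁻¹) ‖y‖) ∧
    ∫ y : V, (Iic R).indicator (fun r => r⁻¹) ‖y‖ ≤
      Module.finrank ℝ V * volume.real (ball (0 : V) 1) * R ^ (Module.finrank ℝ V - 1) := by
  have : Nontrivial V := Module.nontrivial_of_finrank_pos (R := ℝ) (by omega)
  obtain ⟨k, hk⟩ : ∃ k, Module.finrank ℝ V = k + 2 := ⟨_, (Nat.sub_add_cancel hV).symm⟩
  have hfun : EqOn (fun r : ℝ => r ^ (Module.finrank ℝ V - 1) • (Iic R).indicator (fun r => r⁻¹) r)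
      ((Iic R).indicator fun r => r ^ k) (Ioi 0) := by
    intro r hr
    have hr' : r ≠ 0 := ne_of_gt hr
    by_cases h : r ∈ Iic R
    · simp only [indicator_of_mem h, hk, smul_eq_mul]
      rw [show k + 2 - 1 = k + 1 by omega, pow_succ]
      field_simp
    · simp [indicator_of_notMem h]
  have hset : Ioi (0 : ℝ) ∩ Iic R = Ioc 0 R := rfl
  constructor
  · rw [integrable_fun_norm_addHaar volume (f := (Iic R).indicator fun r => r⁻¹),
      integrableOn_congr_fun hfun measurableSet_Ioi, IntegrableOn,
      integrable_indicator_iff measurableSet_Iic, IntegrableOn,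
      Measure.restrict_restrict measurableSet_Iic, inter_comm, hset]
    exact (by fun_prop : Continuous fun r : ℝ => r ^ k).continuousOn.integrableOn_Icc.mono_set
      Ioc_subset_Icc_self
  · rw [integral_fun_norm_addHaar volume (f := (Iic R).indicator fun r => r⁻¹),
      setIntegral_congr_fun measurableSet_Ioi hfun, setIntegral_indicator measurableSet_Iic, hset,
      ← intervalIntegral.integral_of_le hR, integral_pow, nsmul_eq_mul, smul_eq_mul, ← mul_assoc,
      hk, show k + 2 - 1 = k + 1 by omega]
    gcongr
    rw [zero_pow (by omega), sub_zero]
    exact div_le_self (by positivity) (by linarith [k.cast_nonneg (α := ℝ)])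

/-- The integrands differ only where `N y < s`, hence inside `‖y‖ ≤ s / c`, and there by at most `(c
* ‖y‖)⁻¹`. With `d = finrank V`, this integrates to `O(s ^ (d - 1))`, and `d ≥ 4` gives the exponent
`3`. -/
theorem exists_gaussianProfile_zero_sub_le (hV : 4 ≤ Module.finrank ℝ V) (hNc : Continuous N)
    (hc : 0 < c) (hN : ∀ y, c * ‖y‖ ≤ N y) :
    ∃ C : ℝ, 0 < C ∧ ∀ s, 0 < s → s ≤ 1 →
      gaussianProfile N 0 - gaussianProfile N (s ^ 2) ≤ C * s ^ 3 := by
  have : Nontrivial V := Module.nontrivial_of_finrank_pos (R := ℝ) (by omega)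
  have hV2 : 2 ≤ Module.finrank ℝ V := by omega
  set A := Module.finrank ℝ V * volume.real (ball (0 : V) 1) with hA
  have hA0 : 0 ≤ A := by positivity
  set D := c⁻¹ * (A * c⁻¹ ^ (Module.finrank ℝ V - 1)) with hD
  refine ⟨D + 1, by positivity, fun s hs0 hs1 => ?_⟩
  obtain ⟨hi, hle⟩ := integrable_and_integral_indicator_norm_inv_le (V := V) hV2 (R := s * c⁻¹) (by positivity)
  have i0 := integrable_inv_max_mul_exp hV2 hNc hc hN √0
  have i1 := integrable_inv_max_mul_exp hV2 hNc hc hN √(s ^ 2)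
  calc gaussianProfile N 0 - gaussianProfile N (s ^ 2)
      ≤ ∫ y : V, c⁻¹ * (Iic (s * c⁻¹)).indicator (fun r => r⁻¹) ‖y‖ := by
        rw [gaussianProfile, gaussianProfile, ← integral_sub i0 i1]
        refine integral_mono_ae (i0.sub i1) (hi.const_mul _) ?_
        filter_upwards [Measure.ae_ne volume (0 : V)] with y hy
        have hy' := norm_pos_iff.2 hy
        have hNy : 0 < N y := lt_of_lt_of_le (mul_pos hc hy') (hN y)
        simp only [Real.sqrt_zero, Real.sqrt_sq hs0.le, max_eq_right hNy.le]
        by_cases h : ‖y‖ ∈ Iic (s * c⁻¹)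
        · rw [indicator_of_mem h, ← mul_inv]
          have h1 : (N y)⁻¹ ≤ (c * ‖y‖)⁻¹ := inv_anti₀ (by positivity) (hN y)
          have h2 : Real.exp (-(1 / 2) * ‖y‖ ^ 2) ≤ 1 :=
            Real.exp_le_one_iff.2 (by nlinarith [sq_nonneg ‖y‖])
          have h3 : 0 ≤ (max s (N y))⁻¹ * Real.exp (-(1 / 2) * ‖y‖ ^ 2) := by positivity
          have h4 : (N y)⁻¹ * Real.exp (-(1 / 2) * ‖y‖ ^ 2) ≤ (N y)⁻¹ :=
            mul_le_of_le_one_right (by positivity) h2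
          linarith
        · have h1 : s ≤ N y := by
            rw [mem_Iic, not_le, ← div_eq_mul_inv, div_lt_iff₀ hc] at h
            linarith [hN y]
          rw [max_eq_right h1, sub_self, indicator_of_notMem h, mul_zero]
    _ ≤ c⁻¹ * (A * (s * c⁻¹) ^ (Module.finrank ℝ V - 1)) := by
        rw [integral_const_mul]
        gcongr
    _ = D * s ^ (Module.finrank ℝ V - 1) := by rw [mul_pow, hD]; ring
    _ ≤ D * s ^ 3 := by
        gcongr D * ?_
        exact pow_le_pow_of_le_one hs0.le hs1 (by omega)
    _ ≤ (D + 1) * s ^ 3 := by gcongr; linarith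

theorem exists_integral_testProfile_mul_gaussianProfile_neg (hV : 4 ≤ Module.finrank ℝ V)
    (hNc : Continuous N) (hc : 0 < c) (hN : ∀ y, c * ‖y‖ ≤ N y) (hN0 : N 0 = 0) :
    ∃ z : ℝ, 0 ≤ z ∧ z ≤ 1 ∧
      ∫ x : ℝ, testProfile z x * Real.exp (-(1 / 2) * x ^ 2) * gaussianProfile N (x ^ 2) < 0 := by
  obtain ⟨C, hC, hle⟩ := exists_gaussianProfile_zero_sub_le hV hNc hc hN
  have hV2 : 2 ≤ Module.finrank ℝ V := by omega
  have hlt := sub_pos.2 (gaussianProfile_one_lt hV2 hNc hc hN hN0)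
  set δ := gaussianProfile N 0 - gaussianProfile N 1
  -- Chosen so that `C * s ^ 3 ≤ s ^ 2 * δ / 4 < z * δ` with `z = s ^ 2 / 2`, for which `2 * z = s ^
  -- 2`.
  set s := min 1 (δ / (4 * C)) with hs
  have hs0 : 0 < s := by positivity
  have hs1 : s ≤ 1 := min_le_left _ _
  have hs2 : s * (4 * C) ≤ δ := (le_div_iff₀ (by positivity)).1 (min_le_right _ _)
  have hz1 : s ^ 2 / 2 ≤ 1 := by nlinarith
  refine ⟨s ^ 2 / 2, by positivity, hz1, ?_⟩
  have := integral_abs_mul_convexityTest_mul_neg (antitone_gaussianProfile hV2 hNc hc hN)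
    (z := s ^ 2 / 2) (by positivity) hz1 (by
      rw [show 2 * (s ^ 2 / 2) = s ^ 2 by ring]
      refine (hle s hs0 hs1).trans_lt ?_
      have : C * s ^ 3 = s ^ 2 * (s * (4 * C)) / 4 := by ring
      rw [this]
      have h2 : 0 < s ^ 2 * δ := by positivity
      have h3 : s ^ 2 * (s * (4 * C)) ≤ s ^ 2 * δ := by gcongr
      have h4 : s ^ 2 / 2 * δ = s ^ 2 * δ / 2 := by ring
      change _ < s ^ 2 / 2 * δ
      rw [h4]
      linarith)
  refine lt_of_eq_of_lt (integral_congr_ae (.of_forall fun x => ?_)) this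
  simp only [testProfile]
  have : Real.exp (1 / 2 * x ^ 2) * Real.exp (-(1 / 2) * x ^ 2) = 1 := by
    rw [← Real.exp_add]; simp
  linear_combination (|x| * convexityTest (s ^ 2 / 2) (x ^ 2) * gaussianProfile N (x ^ 2)) * this

end Estimates

/-! ### Linear coordinates adapted to the direct sum. -/

section DirectSum

open Set

variable {E : Type*} [NormedAddCommGroup E] [NormedSpace ℝ E]

theorem mem_nhds_zero_of_convex_of_symm {K : Set E} (hconv : Convex ℝ K)
    (hint : (interior K).Nonempty) (hsymm : ∀ z ∈ K, -z ∈ K) : K ∈ nhds 0 := by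
  obtain ⟨x, hx⟩ := hint
  have hneg : -K = K := by
    ext z
    exact ⟨fun h => by simpa using hsymm _ h, fun h => hsymm _ h⟩
  have hx' : -x ∈ interior K := by
    have : interior (-K) = -interior K := (Homeomorph.neg E).preimage_interior K |>.symm
    rw [hneg] at this
    rw [this]
    simpa using hx
  have h0 := hconv.interior hx hx' (a := 1 / 2) (b := 1 / 2) (by norm_num) (by norm_num)
    (by norm_num)
  rw [smul_neg, add_neg_cancel] at h0
  exact mem_interior_iff_mem_nhds.1 h0

theorem gauge_smul_add_eq_max {K : Set E} (hconv : Convex ℝ K) (hclosed : IsClosed K)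
    (h0 : K ∈ nhds 0) {b : E} {F : Submodule ℝ E}
    (hK : ∀ t : ℝ, ∀ y ∈ F, t • b + y ∈ K ↔ |t| ≤ 1 ∧ y ∈ K) (t : ℝ) {y : E} (hy : y ∈ F) :
    gauge K (t • b + y) = max |t| (gauge K y) := by
  have hle : ∀ r : ℝ, 0 < r → ∀ p, gauge K p ≤ r ↔ r⁻¹ • p ∈ K := fun r hr p => by
    rw [← hclosed.closure_eq, ← gauge_le_one_iff_mem_closure hconv h0,
      gauge_smul_of_nonneg (inv_nonneg.2 hr.le), smul_eq_mul, inv_mul_le_iff₀ hr, mul_one,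
      hclosed.closure_eq]
  have key : ∀ r : ℝ, 0 < r → (gauge K (t • b + y) ≤ r ↔ max |t| (gauge K y) ≤ r) := by
    intro r hr
    rw [hle r hr, max_le_iff, hle r hr, smul_add, smul_smul, hK _ _ (F.smul_mem _ hy), abs_mul,
      abs_of_pos (inv_pos.2 hr), inv_mul_le_iff₀ hr, mul_one]
  refine le_antisymm (le_of_forall_pos_le_add fun ε hε => ?_)
    (le_of_forall_pos_le_add fun ε hε => ?_)
  · exact (key _ (add_pos_of_nonneg_of_pos (le_max_of_le_left (abs_nonneg t)) hε)).2
      (le_add_of_nonneg_right hε.le)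
  · exact (key _ (add_pos_of_nonneg_of_pos (gauge_nonneg _) hε)).1 (le_add_of_nonneg_right hε.le)

/-- Symmetry of `K` and uniqueness of the decomposition make the segment itself symmetric, so `a =
-b` and `b` serves as the unit vector of the first coordinate. -/
theorem exists_isCompl_of_eq_segment_add [FiniteDimensional ℝ E] {K B : Set E}
    (hB : B.Nonempty) (hsymm : ∀ z ∈ K, -z ∈ K) {a b : E} (hab : a ≠ b)
    (hK : K = segment ℝ a b + B) {A F : Submodule ℝ E} (hAF : IsCompl A F)
    (hA : segment ℝ a b ⊆ A) (hBF : B ⊆ F)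
    (hdim : Module.finrank ℝ (vectorSpan ℝ B) + 1 = Module.finrank ℝ E) :
    Module.finrank ℝ F + 1 = Module.finrank ℝ E ∧ IsCompl (Submodule.span ℝ {b}) F ∧ b ≠ 0 ∧
      ∀ t : ℝ, ∀ y ∈ F, t • b + y ∈ K ↔ |t| ≤ 1 ∧ y ∈ K := by
  have huniq : ∀ x ∈ A, ∀ x' ∈ A, ∀ y ∈ F, ∀ y' ∈ F, x + y = x' + y' → x = x' ∧ y = y' := by
    intro x hx x' hx' y hy y' hy' h
    have h1 : x - x' = y' - y := by
      rw [sub_eq_sub_iff_add_eq_add, h, add_comm]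
    have h2 : x - x' ∈ A ⊓ F := ⟨A.sub_mem hx hx', h1 ▸ F.sub_mem hy' hy⟩
    rw [hAF.inf_eq_bot, Submodule.mem_bot] at h2
    exact ⟨sub_eq_zero.1 h2, (sub_eq_zero.1 (h1 ▸ h2)).symm⟩
  have hneg : ∀ x ∈ segment ℝ a b, -x ∈ segment ℝ a b := by
    intro x hx
    obtain ⟨y, hy⟩ := hB
    have h := hsymm (x + y) (hK ▸ add_mem_add hx hy)
    rw [hK] at h
    obtain ⟨x', hx', y', hy', h⟩ := h
    simp only [neg_add] at h
    have := (huniq _ (hA hx') _ (A.neg_mem (hA hx)) _ (hBF hy') _ (F.neg_mem (hBF hy)) h).1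
    exact this ▸ hx'
  -- That `-a` lies in the segment gives `a = -k b` with `0 ≤ k ≤ 1`; that `-b` does gives `1 + s₂ =
  -- s₁ k ≤ k`, which forces `k = 1`.
  obtain ⟨s₁, s₂, hs₁, hs₂, hs, e1⟩ := hneg b (right_mem_segment ℝ a b)
  obtain ⟨u₁, u₂, hu₁, hu₂, hu, e2⟩ := hneg a (left_mem_segment ℝ a b)
  have hu₁' : 0 < 1 + u₁ := by linarith
  have ha : a = -((u₂ / (1 + u₁)) • b) := by
    have : (1 + u₁) • a = -(u₂ • b) := by
      rw [add_smul, one_smul, eq_neg_iff_add_eq_zero, add_assoc, e2, add_neg_cancel]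
    rw [← smul_neg, div_eq_inv_mul, mul_smul, smul_neg, ← this, smul_smul,
      inv_mul_cancel₀ hu₁'.ne', one_smul]
  set k := u₂ / (1 + u₁) with hk
  have hk1 : k ≤ 1 := (div_le_one hu₁').2 (by linarith)
  have hk0 : 0 ≤ k := by positivity
  have hb : b ≠ 0 := by
    rintro rfl
    exact hab (by simp [ha])
  have h1 : (1 + s₂ - s₁ * k) • b = 0 := by
    rw [ha] at e1
    have : (1 + s₂ - s₁ * k) • b = b + (s₁ • -(k • b) + s₂ • b) := by module
    rw [this, e1, add_neg_cancel]
  have h2 : 1 + s₂ - s₁ * k = 0 := (smul_eq_zero.1 h1).resolve_right hb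
  have hk' : k = 1 := by
    have : s₁ * k ≤ k := mul_le_of_le_one_left hk0 (by linarith)
    linarith
  have hab' : a = -b := by rw [ha, hk', one_smul]
  have hbA : b ∈ A := hA (right_mem_segment ℝ a b)
  have hspan : Submodule.span ℝ {b} ≤ A := by
    rwa [Submodule.span_singleton_le_iff_mem]
  have hvec : vectorSpan ℝ B ≤ F := by
    rw [vectorSpan_def, Submodule.span_le]
    rintro _ ⟨x, hx, y, hy, rfl⟩
    exact F.sub_mem (hBF hx) (hBF hy)
  have d1 := Submodule.finrank_mono hspan
  rw [finrank_span_singleton hb] at d1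
  have d2 := Submodule.finrank_mono hvec
  have d3 := Submodule.finrank_add_eq_of_isCompl hAF
  -- Since `F` contains `vectorSpan ℝ B`, of codimension one, its complement `A` has no room beyond
  -- the line of `b`.
  have hspan' : Submodule.span ℝ {b} = A :=
    Submodule.eq_of_le_of_finrank_eq hspan (by rw [finrank_span_singleton hb]; omega)
  refine ⟨by omega, hspan' ▸ hAF, hb, ?_⟩
  have hseg : ∀ t : ℝ, t • b ∈ segment ℝ a b ↔ |t| ≤ 1 := by
    intro t
    rw [hab', abs_le]
    constructor
    · rintro ⟨p, q, hp, hq, hpq, h⟩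
      have : (q - p - t) • b = 0 := by
        rw [sub_smul, ← h]; module
      have := (smul_eq_zero.1 this).resolve_right hb
      constructor <;> linarith
    · rintro ⟨ht1, ht2⟩
      exact ⟨(1 - t) / 2, (1 + t) / 2, by linarith, by linarith, by ring, by module⟩
  have hmem : ∀ t : ℝ, ∀ y ∈ F, t • b + y ∈ K ↔ |t| ≤ 1 ∧ y ∈ B := by
    intro t y hy
    rw [← hseg]
    constructor
    · rw [hK]
      rintro ⟨x', hx', y', hy', h⟩
      obtain ⟨e1, e2⟩ := huniq _ (hA hx') _ (A.smul_mem t hbA) _ (hBF hy') _ hy h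
      exact ⟨e1 ▸ hx', e2 ▸ hy'⟩
    · rintro ⟨h1, h2⟩
      exact hK ▸ add_mem_add h1 h2
  intro t y hy
  rw [hmem t y hy]
  have := hmem 0 y hy
  simp only [zero_smul, zero_add, abs_zero, zero_le_one, true_and] at this
  rw [this]

/-- The linear coordinates `(t, y) ↦ t • b + y` attached to a decomposition `ℝ b ⊕ F`. -/
noncomputable def lineProdEquiv {b : E} {F : Submodule ℝ E} (hb : b ≠ 0)
    (h : IsCompl (Submodule.span ℝ {b}) F) : (ℝ × F) ≃ₗ[ℝ] E :=
  LinearEquiv.prodCongr (LinearEquiv.toSpanNonzeroSingleton ℝ E b hb) (LinearEquiv.refl ℝ F) ≪≫ₗ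
    Submodule.prodEquivOfIsCompl _ _ h

theorem lineProdEquiv_apply {b : E} {F : Submodule ℝ E} (hb : b ≠ 0)
    (h : IsCompl (Submodule.span ℝ {b}) F) (x : ℝ × F) :
    lineProdEquiv hb h x = x.1 • b + (x.2 : E) := by
  simp [lineProdEquiv]

end DirectSum

/-! ### Assembly of the test function and the contradiction. -/

section Main

open Set

/-- Fubini; integrability follows by replacing `|x.1|` with `0` in the maximum, which leaves a
product majorant. -/
theorem integral_prod_inv_max_mul {V : Type*} [NormedAddCommGroup V] [InnerProductSpace ℝ V]
    [FiniteDimensional ℝ V] [MeasurableSpace V] [BorelSpace V] (hV : 2 ≤ Module.finrank ℝ V)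
    {N : V → ℝ} {c : ℝ} (hNc : Continuous N) (hc : 0 < c) (hN : ∀ y, c * ‖y‖ ≤ N y)
    {z : ℝ} (hz : z ≤ 1) :
    ∫ x : ℝ × V, (max |x.1| (N x.2))⁻¹ *
        (testProfile z x.1 * Real.exp (-(1 / 2) * (x.1 ^ 2 + ‖x.2‖ ^ 2))) =
      ∫ t : ℝ, testProfile z t * Real.exp (-(1 / 2) * t ^ 2) * gaussianProfile N (t ^ 2) := by
  obtain ⟨M, hM⟩ := exists_abs_testProfile_le hz
  have hM0 : 0 ≤ M := (abs_nonneg _).trans (hM 0)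
  have hN0 : ∀ y, 0 ≤ N y := fun y => le_trans (by positivity) (hN y)
  have hw := continuous_testProfile z
  have hint : Integrable (fun x : ℝ × V => (max |x.1| (N x.2))⁻¹ *
      (testProfile z x.1 * Real.exp (-(1 / 2) * (x.1 ^ 2 + ‖x.2‖ ^ 2))))
      ((volume : Measure ℝ).prod volume) := by
    have h1 : Integrable fun t : ℝ => M * Real.exp (-(1 / 2) * t ^ 2) :=
      (integrable_exp_neg_mul_sq (by norm_num)).const_mul M
    have h2 := integrable_inv_max_mul_exp hV hNc hc hN 0
    refine (h1.mul_prod h2).mono' ?_ ?_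
    · have : Measurable fun x : ℝ × V => (max |x.1| (N x.2))⁻¹ :=
        (by fun_prop : Continuous fun x : ℝ × V => max |x.1| (N x.2)).measurable.inv
      exact (this.mul (by fun_prop : Continuous fun x : ℝ × V => testProfile z x.1 *
        Real.exp (-(1 / 2) * (x.1 ^ 2 + ‖x.2‖ ^ 2))).measurable).aestronglyMeasurable
    · have hnull : ∀ᵐ x : ℝ × V ∂((volume : Measure ℝ).prod volume), x.2 ≠ 0 := by
        have : Nontrivial V := Module.nontrivial_of_finrank_pos (R := ℝ) (by omega)
        exact Measure.quasiMeasurePreserving_snd.ae (Measure.ae_ne volume (0 : V))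
      filter_upwards [hnull] with x hx
      have h3 := inv_max_le hc (hN x.2) hx (abs_nonneg x.1)
      have h0 : 0 ≤ (max |x.1| (N x.2))⁻¹ := inv_nonneg.2 (le_max_of_le_left (abs_nonneg _))
      rw [norm_mul, norm_mul, Real.norm_eq_abs, Real.norm_eq_abs, Real.norm_eq_abs,
        abs_of_nonneg h0, abs_of_pos (Real.exp_pos _), mul_add, Real.exp_add]
      calc _ ≤ (max 0 (N x.2))⁻¹ * (M * (Real.exp (-(1 / 2) * x.1 ^ 2) *
            Real.exp (-(1 / 2) * ‖x.2‖ ^ 2))) := by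
            gcongr
            exact hM _
        _ = _ := by ring
  rw [Measure.volume_eq_prod, integral_prod _ hint]
  refine integral_congr_ae (.of_forall fun t => ?_)
  simp only [gaussianProfile]
  rw [← integral_const_mul]
  refine integral_congr_ae (.of_forall fun y => ?_)
  simp only [Real.sqrt_sq_eq_abs]
  rw [mul_add, Real.exp_add]
  ring

theorem not_isIntersectionBody_of_gauge_eq_max {n : ℕ} (hn : 5 ≤ n)
    {K : Set (EuclideanSpace ℝ (Fin n))} (hconv : Convex ℝ K) (hclosed : IsClosed K)
    (h0 : K ∈ nhds 0) (hbdd : Bornology.IsBounded K) {b : EuclideanSpace ℝ (Fin n)}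
    {F : Submodule ℝ (EuclideanSpace ℝ (Fin n))} (hF : Module.finrank ℝ F + 1 = n)
    (hb : b ≠ 0) (hcompl : IsCompl (Submodule.span ℝ {b}) F)
    (hgauge : ∀ t : ℝ, ∀ y ∈ F, gauge K (t • b + y) = max |t| (gauge K y)) :
    ¬ IsIntersectionBody K := by
  intro hK
  obtain ⟨R, hR0, hR⟩ : ∃ R : ℝ, 0 < R ∧ K ⊆ closedBall 0 R := by
    obtain ⟨R, hR⟩ := hbdd.subset_closedBall 0
    exact ⟨max R 1, by positivity, hR.trans (closedBall_subset_closedBall (le_max_left _ _))⟩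
  set N : F → ℝ := fun y => gauge K y with hNdef
  have hNc : Continuous N := (continuous_gauge hconv h0).comp continuous_subtype_val
  have hN : ∀ y, R⁻¹ * ‖y‖ ≤ N y := fun y => by
    rw [inv_mul_eq_div]
    exact le_gauge_of_subset_closedBall (absorbent_nhds_zero (𝕜 := ℝ) h0) hR0.le hR
  obtain ⟨z, hz0, hz1, hneg⟩ := exists_integral_testProfile_mul_gaussianProfile_neg
    (by omega) hNc (inv_pos.2 hR0) hN (by simp [hNdef])
  set e := (lineProdEquiv hb hcompl).symm with he
  -- The ℓ² norm on `ℝ × F` makes the Gaussian split into its `x` and `y` factors, although the line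
  -- of `b` and `F` need not be orthogonal in the original space.
  set T : EuclideanSpace ℝ (Fin n) →ₗ[ℝ] WithLp 2 (ℝ × F) :=
    (e ≪≫ₗ (WithLp.linearEquiv 2 ℝ (ℝ × F)).symm).toLinearMap with hT
  have hTinj : Function.Injective T := LinearEquiv.injective _
  have hTnorm : ∀ p, ‖T p‖ ^ 2 = (e p).1 ^ 2 + ‖(e p).2‖ ^ 2 := fun p => by
    rw [WithLp.prod_norm_sq_eq_of_L2]
    simp [hT]
  set L : StrongDual ℝ (WithLp 2 (ℝ × F)) := WithLp.fstL 2 ℝ ℝ F with hL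
  have hL1 : ‖L‖ ≤ 1 := by
    refine L.opNorm_le_bound zero_le_one fun x => ?_
    have h := WithLp.prod_norm_sq_eq_of_L2 x
    have h2 : ‖L x‖ = ‖x.fst‖ := rfl
    rw [one_mul, h2]
    exact le_of_sq_le_sq (by nlinarith [sq_nonneg ‖x.snd‖]) (norm_nonneg _)
  set φ : EuclideanSpace ℝ (Fin n) → ℝ := fun p =>
    testProfile z (L (T p)) * Real.exp (-(1 / 2) * ‖T p‖ ^ 2) with hφ
  have hTc : Continuous T := T.continuous_of_finiteDimensional
  have hw := continuous_testProfile z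
  have hφc : Continuous φ := by
    have : Continuous L := L.continuous
    fun_prop
  obtain ⟨M, hM⟩ := exists_abs_testProfile_le hz1
  -- The antilipschitz constant converts decay in `‖T p‖` into decay in `‖p‖`.
  obtain ⟨κ, hκ, hanti⟩ := T.exists_antilipschitzWith (LinearMap.ker_eq_bot.2 hTinj)
  have hκ' : (0 : ℝ) < κ := hκ
  have hbd : ∀ p, |φ p| ≤ M * Real.exp (-(1 / (2 * (κ : ℝ) ^ 2)) * ‖p‖ ^ 2) := by
    intro p
    have h1 : ‖p‖ ≤ κ * ‖T p‖ := by simpa using hanti.le_mul_dist p 0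
    have h2 : ‖p‖ ^ 2 ≤ (κ * ‖T p‖) ^ 2 := by gcongr
    rw [hφ, abs_mul, abs_of_pos (Real.exp_pos _)]
    refine mul_le_mul (hM _) (Real.exp_le_exp.2 ?_) (Real.exp_pos _).le
      ((abs_nonneg _).trans (hM 0))
    rw [neg_mul, neg_mul, neg_le_neg_iff, one_div_mul_eq_div, div_le_iff₀ (by positivity)]
    linarith
  have hpos := hK.integral_inv_gauge_mul_nonneg (by omega) hconv hclosed h0 hbdd hφc
    (by positivity) hbd fun ξ _ =>
      integral_testProfile_mul_exp_nonneg hz0 hz1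
        (T.comp (Submodule.span ℝ {ξ})ᗮ.subtype) (hTinj.comp Subtype.val_injective) L hL1
  obtain ⟨c, hc, hcint⟩ := exists_integral_comp_linearEquiv e volume (volume.prod volume)
  have h1 := hcint fun x => (max |x.1| (N x.2))⁻¹ *
        (testProfile z x.1 * Real.exp (-(1 / 2) * (x.1 ^ 2 + ‖x.2‖ ^ 2)))
  rw [← Measure.volume_eq_prod,
    integral_prod_inv_max_mul (by omega) hNc (inv_pos.2 hR0) hN hz1] at h1
  have h2 : ∀ p, (gauge K p)⁻¹ * φ p = (max |(e p).1| (N (e p).2))⁻¹ *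
      (testProfile z (e p).1 * Real.exp (-(1 / 2) * ((e p).1 ^ 2 + ‖(e p).2‖ ^ 2))) := by
    intro p
    have hp : p = (e p).1 • b + ((e p).2 : EuclideanSpace ℝ (Fin n)) := by
      rw [← lineProdEquiv_apply hb hcompl, he, LinearEquiv.apply_symm_apply]
    rw [← hTnorm, hNdef, ← hgauge _ _ (e p).2.2, ← hp]
    rfl
  simp_rw [h2] at hpos
  rw [h1] at hpos
  exact absurd hpos (not_le.2 (mul_neg_of_pos_of_neg hc hneg))

end Main

theorem mainTheorem1 (n : ℕ) (hn : 5 ≤ n)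
    (K B : ConvexBody (EuclideanSpace ℝ (Fin n)))
    (hKint : (interior (K : Set (EuclideanSpace ℝ (Fin n)))).Nonempty)
    (hKsymm : ∀ z ∈ K, -z ∈ K)
    (a b : EuclideanSpace ℝ (Fin n)) (hab : a ≠ b)
    (hBdim : Module.finrank ℝ (vectorSpan ℝ (B : Set (EuclideanSpace ℝ (Fin n)))) = n - 1)
    (hK : IsDirectSum (K : Set (EuclideanSpace ℝ (Fin n))) (segment ℝ a b)
      (B : Set (EuclideanSpace ℝ (Fin n)))) :
    ¬ IsIntersectionBody (K : Set (EuclideanSpace ℝ (Fin n))) := by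
  obtain ⟨hKB, A, F, hAF, hA, hBF⟩ := hK
  have h0 := mem_nhds_zero_of_convex_of_symm K.convex hKint hKsymm
  obtain ⟨hF, hcompl, hb, hmem⟩ := exists_isCompl_of_eq_segment_add B.nonempty hKsymm hab hKB hAF
    hA hBF (by rw [hBdim, finrank_euclideanSpace, Fintype.card_fin]; omega)
  rw [finrank_euclideanSpace, Fintype.card_fin] at hF
  exact not_isIntersectionBody_of_gauge_eq_max hn K.convex K.isClosed h0 K.isCompact.isBounded hF
    hb hcompl fun t y hy => gauge_smul_add_eq_max K.convex K.isClosed h0 hmem t hy
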